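/- Let $f(x)=\sum_{n\ge 0}a_nx^n\in\mathbb{Z}[[x]]$ be a formal power series with integer coefficients such that the set $\{a_n : n\ge 0\}$ is finite. Regard $f$ as an element of the field $\mathbb{Q}((x))$ of formal Laurent series, which contains the field of rational functions $\mathbb{Q}(x)$ through expansion at $x=0$. Then exactly one of the following holds: $f(x)\in\mathbb{Q}(x)$, or $f(x)$ is transcendental over $\mathbb{Q}(x)$. Moreover, if $f(x)\in\mathbb{Q}(x)$, then the sequence $(a_n)_{n\ge 0}$ is eventually periodic, that is, there are integers $N\ge 0$ and $T\ge 1$ such that $a_{n+T}=a_n$ for all $n\ge N$. -/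

import Mathlib

-- This makes the algebra structure of `LaurentSeries ℚ` over `RatFunc ℚ` available.
open scoped RatFunc

/-- A sequence is eventually periodic if, from some index on, it repeats with some positive
period. -/
def EventuallyPeriodic {α : Type*} (a : ℕ → α) : Prop :=
  ∃ N T : ℕ, 0 < T ∧ ∀ n, N ≤ n → a (n + T) = a n

/-- An integral power series viewed in the field `ℚ((x))` of formal Laurent series, of which the
field `ℚ(x)` of rational functions is a subfield through `algebraMap` (expansion at `0`). -/
noncomputable def PowerSeries.toRatLaurent (f : PowerSeries ℤ) : LaurentSeries ℚ :=
  HahnSeries.ofPowerSeries ℤ ℚ (PowerSeries.map (Int.castRingHom ℚ) f)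

/-- `f ∈ ℚ(x)`: the integral power series `f` is the expansion of a rational function. -/
def PowerSeries.IsRational (f : PowerSeries ℤ) : Prop :=
  ∃ r : RatFunc ℚ, algebraMap (RatFunc ℚ) (LaurentSeries ℚ) r = f.toRatLaurent

/-! Let θ = x·d/dx. If f is algebraic over ℚ(x), all θ^i f lie in the finite extension ℚ(x)(f), so ∑
c_i θ^i f = 0 for some polynomials c_i, not all zero (`Derivation.not_linearIndependent_iterate`).
Since θ^i multiplies a_n by n^i, divide the n-th coefficient by n^r, r the top order. As the a_n are
bounded, only the term i = r survives as n → ∞, so the coefficients of c_r f tend to 0. They take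
finitely many values, hence vanish eventually, and f is rational. For rational f, a
constant-coefficient recurrence and the pigeonhole principle give periodicity. -/

/-! ### Derivations and algebraic elements -/

open Polynomial in
/-- A polynomial relation of minimal degree is separable in characteristic zero. -/
theorem IsAlgebraic.exists_aeval_derivative_ne_zero {A B : Type*} [CommRing A] [IsDomain A]
    [CharZero A] [CommRing B] [Algebra A B] [FaithfulSMul A B] {x : B} (hx : IsAlgebraic A x) :
    ∃ p : A[X], aeval x p = 0 ∧ aeval x (derivative p) ≠ 0 := by
  classical
  have hex : ∃ n, ∃ p : A[X], p ≠ 0 ∧ aeval x p = 0 ∧ p.natDegree = n := by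
    obtain ⟨p, hp, hpx⟩ := hx
    exact ⟨_, p, hp, hpx, rfl⟩
  obtain ⟨p, hp, hpx, hdeg⟩ := Nat.find_spec hex
  refine ⟨p, hpx, fun h ↦ ?_⟩
  by_cases h0 : p.natDegree = 0
  · rw [eq_C_of_natDegree_eq_zero h0, aeval_C] at hpx
    rw [eq_C_of_natDegree_eq_zero h0, (FaithfulSMul.algebraMap_injective A B).eq_iff'
      (map_zero _) |>.1 hpx, C_0] at hp
    exact hp rfl
  · refine Nat.find_min hex (m := (derivative p).natDegree) ?_ ⟨_, ?_, h, rfl⟩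
    · rw [← hdeg]
      exact natDegree_derivative_lt h0
    · exact fun h' ↦ h0 (derivative_eq_zero.1 h')

section

variable {R A B : Type*} [CommRing R] [CommRing A] [CommRing B] [Algebra A B] [Algebra R B]

-- Here `s` is `p` with `d` applied to its coefficients, evaluated at `x`; only its membership in
-- `A[x]` matters later.
open Polynomial in
theorem Derivation.exists_apply_aeval_eq (d : Derivation R B B)
    (hd : ∀ a : A, ∃ b : A, d (algebraMap A B a) = algebraMap A B b) (x : B) (p : A[X]) :
    ∃ s ∈ Algebra.adjoin A {x}, d (aeval x p) = s + aeval x (derivative p) * d x := by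
  induction p using Polynomial.induction_on' with
  | add p q hp hq =>
    obtain ⟨s, hs, hs'⟩ := hp
    obtain ⟨t, ht, ht'⟩ := hq
    refine ⟨s + t, add_mem hs ht, ?_⟩
    simp only [map_add, hs', ht']
    ring
  | monomial n a =>
    obtain ⟨b, hb⟩ := hd a
    refine ⟨x ^ n * algebraMap A B b, mul_mem (pow_mem (Algebra.self_mem_adjoin_singleton A x) n)
      (Subalgebra.algebraMap_mem _ b), ?_⟩
    simp only [aeval_monomial, Derivation.leibniz, Derivation.leibniz_pow, hb, smul_eq_mul,
      derivative_monomial, map_mul, nsmul_eq_mul]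
    rw [_root_.map_natCast]
    ring

-- Differentiating `p(x) = 0` shows that `w * d x` lies in `A[x]`, where `w = p'(x)`. Hence `w * d`
-- preserves `A[x]`, and powers of `w` clear the denominators of all iterates.
open Polynomial in
theorem Derivation.exists_pow_mul_iterate_mem_adjoin (d : Derivation R B B)
    (hd : ∀ a : A, ∃ b : A, d (algebraMap A B a) = algebraMap A B b) (x : B) (p : A[X])
    (hp : aeval x p = 0) (i : ℕ) :
    ∃ m : ℕ, aeval x (derivative p) ^ m * d^[i] x ∈ Algebra.adjoin A {x} := by
  set w := aeval x (derivative p) with hw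
  set S := Algebra.adjoin A {x}
  have hwS : w ∈ S := aeval_mem_adjoin_singleton A x
  have hwx : w * d x ∈ S := by
    obtain ⟨s, hs, h⟩ := d.exists_apply_aeval_eq hd x p
    rw [hp, map_zero] at h
    rw [show w * d x = -s by linear_combination -h]
    exact neg_mem hs
  have hwd : ∀ y ∈ S, w * d y ∈ S := by
    intro y hy
    rw [show S = _ from Algebra.adjoin_singleton_eq_range_aeval A x] at hy
    obtain ⟨q, rfl⟩ := hy
    obtain ⟨s, hs, h⟩ := d.exists_apply_aeval_eq hd x q
    change w * d (aeval x q) ∈ S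
    rw [h, show w * (s + aeval x (derivative q) * d x) =
      w * s + aeval x (derivative q) * (w * d x) by ring]
    exact add_mem (mul_mem hwS hs) (mul_mem (aeval_mem_adjoin_singleton A x) hwx)
  induction i with
  | zero => exact ⟨0, by simp [S]⟩
  | succ i ih =>
    obtain ⟨m, hm⟩ := ih
    refine ⟨m + 2, ?_⟩
    have h1 := hwd _ hm
    rw [Derivation.leibniz, Derivation.leibniz_pow] at h1
    simp only [smul_eq_mul, nsmul_eq_mul] at h1
    rw [Function.iterate_succ_apply']
    -- The truncated exponent `m - 1` is harmless at `m = 0`, where its term carries the factor `m`.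
    have h2 : w ^ (m + 2) * d (d^[i] x) =
        w * (w * (w ^ m * d (d^[i] x) + d^[i] x * (m * (w ^ (m - 1) * d w))))
          - m * ((w ^ m * d^[i] x) * (w * d w)) := by
      cases m with
      | zero => simp; ring
      | succ m => simp; ring
    rw [h2]
    exact sub_mem (mul_mem hwS h1) (mul_mem (natCast_mem S m) (mul_mem hm (hwd w hwS)))

/-- The iterated derivatives of an algebraic element satisfy a linear differential equation. -/
theorem Derivation.not_linearIndependent_iterate [IsDomain A] [CharZero A] [IsDomain B]
    [FaithfulSMul A B] (d : Derivation R B B)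
    (hd : ∀ a : A, ∃ b : A, d (algebraMap A B a) = algebraMap A B b) {x : B}
    (hx : IsAlgebraic A x) : ¬ LinearIndependent A fun i : ℕ ↦ d^[i] x := by
  let K := FractionRing A
  let L := FractionRing B
  obtain ⟨p, hp, hw⟩ := hx.exists_aeval_derivative_ne_zero
  let : Algebra K L := FractionRing.liftAlgebra A L
  have hxL : IsIntegral K (algebraMap B L x) := by
    rw [← isAlgebraic_iff_isIntegral, ← IsFractionRing.isAlgebraic_iff A K L]
    exact hx.algebraMap
  set E := IntermediateField.adjoin K {algebraMap B L x}
  have hE : FiniteDimensional K E := IntermediateField.adjoin.finiteDimensional hxL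
  have hSE : ∀ y ∈ Algebra.adjoin A {x}, algebraMap B L y ∈ E := by
    intro y hy
    induction hy using Algebra.adjoin_induction with
    | mem y hy =>
      rw [Set.mem_singleton_iff.1 hy]
      exact IntermediateField.mem_adjoin_simple_self K _
    | algebraMap a =>
      rw [← IsScalarTower.algebraMap_apply, IsScalarTower.algebraMap_apply A K L]
      exact E.algebraMap_mem _
    | add y z _ _ hy hz => rw [map_add]; exact add_mem hy hz
    | mul y z _ _ hy hz => rw [map_mul]; exact mul_mem hy hz
  -- In the field `L` the power of `p'(x)` can be divided out.
  have hmem : ∀ i : ℕ, algebraMap B L (d^[i] x) ∈ E := by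
    intro i
    obtain ⟨m, hm⟩ := d.exists_pow_mul_iterate_mem_adjoin hd x p hp i
    have hwE := pow_mem (hSE _ (Polynomial.aeval_mem_adjoin_singleton A x
      (p := Polynomial.derivative p))) m
    have hw0 : algebraMap B L (Polynomial.aeval x (Polynomial.derivative p)) ^ m ≠ 0 :=
      pow_ne_zero _ (by simpa using hw)
    have := mul_mem (inv_mem hwE) (hSE _ hm)
    rwa [map_mul, map_pow, inv_mul_cancel_left₀ hw0] at this
  intro h
  have h1 : LinearIndependent A fun i : ℕ ↦ algebraMap B L (d^[i] x) :=
    h.map_injOn (IsScalarTower.toAlgHom A B L).toLinearMap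
      (IsFractionRing.injective B L).injOn
  rw [LinearIndependent.iff_fractionRing A K] at h1
  have h2 : LinearIndependent K fun i : ℕ ↦ (⟨_, hmem i⟩ : E) :=
    LinearIndependent.of_comp E.val.toLinearMap h1
  exact Module.Finite.not_linearIndependent_of_infinite _ h2

end

/-! ### From a differential equation to a recurrence -/

open Filter Topology in
theorem Filter.Tendsto.eventually_eq_of_finite_range {ι X : Type*} [TopologicalSpace X] [T1Space X]
    {l : Filter ι} {u : ι → X} {x : X} (hu : Tendsto u l (𝓝 x)) (hfin : (Set.range u).Finite) :
    ∀ᶠ n in l, u n = x := by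
  have h : (Set.range u \ {x})ᶜ ∈ 𝓝 x :=
    (hfin.subset Set.sdiff_subset).isClosed.isOpen_compl.mem_nhds (by simp)
  filter_upwards [hu h] with n hn
  by_contra hne
  exact hn ⟨⟨n, rfl⟩, hne⟩

open Filter Topology in
theorem tendsto_natCast_sub_pow_div_pow (k i r : ℕ) (hir : i ≤ r) :
    Tendsto (fun n : ℕ ↦ ((n - k : ℕ) : ℚ) ^ i / (n : ℚ) ^ r) atTop
      (𝓝 (if i = r then 1 else 0)) := by
  have hinv : Tendsto (fun n : ℕ ↦ (n : ℚ)⁻¹) atTop (𝓝 0) :=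
    tendsto_inv_atTop_zero.comp tendsto_natCast_atTop_atTop
  have h1 : Tendsto (fun n : ℕ ↦ (1 - k * (n : ℚ)⁻¹) ^ i * (n : ℚ)⁻¹ ^ (r - i)) atTop
      (𝓝 ((1 - k * 0) ^ i * 0 ^ (r - i))) :=
    ((tendsto_const_nhds.sub (hinv.const_mul _)).pow i).mul (hinv.pow _)
  have h2 : ((1 - k * 0 : ℚ)) ^ i * 0 ^ (r - i) = if i = r then 1 else 0 := by
    split_ifs with h
    · simp [h]
    · simp [zero_pow (show r - i ≠ 0 by omega)]
  rw [h2] at h1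
  refine h1.congr' ?_
  filter_upwards [eventually_ge_atTop (k + 1)] with n hn
  have hn0 : (n : ℚ) ≠ 0 := by exact_mod_cast (by omega : n ≠ 0)
  obtain ⟨j, rfl⟩ := Nat.exists_eq_add_of_le hir
  rw [Nat.cast_sub (by omega), show (1 - k * (n : ℚ)⁻¹) = (n - k) / n by field_simp, div_pow,
    Nat.add_sub_cancel_left, inv_pow, pow_add]
  field_simp

namespace PowerSeries

theorem coeff_coe_mul_of_natDegree_le {R : Type*} [CommSemiring R] (p : Polynomial R)
    (g : PowerSeries R) {D n : ℕ} (hp : p.natDegree ≤ D) (hn : D ≤ n) :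
    coeff n ((p : PowerSeries R) * g) =
      ∑ k ∈ Finset.range (D + 1), p.coeff k * coeff (n - k) g := by
  rw [coeff_mul, Finset.Nat.sum_antidiagonal_eq_sum_range_succ
    (fun k l ↦ coeff k (p : PowerSeries R) * coeff l g)]
  symm
  simp only [Polynomial.coeff_coe]
  refine Finset.sum_subset (Finset.range_mono (by omega)) fun k _ hk ↦ ?_
  rw [Polynomial.coeff_eq_zero_of_natDegree_lt, zero_mul]
  simp only [Finset.mem_range] at hk
  omega

instance faithfulSMul_polynomial {R : Type*} [CommSemiring R] :
    FaithfulSMul (Polynomial R) (PowerSeries R) := by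
  rw [faithfulSMul_iff_algebraMap_injective]
  intro p q h
  simpa [algebraMap_apply'] using h

/-- The Euler operator `X * d/dX` on formal power series. -/
noncomputable def eulerDerivation (R : Type*) [CommRing R] :
    Derivation R (PowerSeries R) (PowerSeries R) :=
  (X : PowerSeries R) • derivative R

theorem coeff_eulerDerivation {R : Type*} [CommRing R] (g : PowerSeries R) (n : ℕ) :
    coeff n (eulerDerivation R g) = n * coeff n g := by
  rw [eulerDerivation, Derivation.smul_apply, smul_eq_mul]
  cases n with
  | zero => simp
  | succ n => rw [coeff_succ_X_mul, coeff_derivative]; push_cast; ring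

theorem coeff_iterate_eulerDerivation {R : Type*} [CommRing R] (g : PowerSeries R) (i n : ℕ) :
    coeff n ((eulerDerivation R)^[i] g) = n ^ i * coeff n g := by
  induction i with
  | zero => simp
  | succ i ih => rw [Function.iterate_succ_apply', coeff_eulerDerivation, ih]; ring

theorem finite_range_coeff_coe_mul {R : Type*} [CommSemiring R] (p : Polynomial R)
    {g : PowerSeries R} (hg : (Set.range fun n ↦ coeff n g).Finite) :
    (Set.range fun n ↦ coeff n ((p : PowerSeries R) * g)).Finite := by
  induction p using Polynomial.induction_on' with
  | add p q hp hq =>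
    refine (hp.add hq).subset ?_
    rintro _ ⟨n, rfl⟩
    exact ⟨_, ⟨n, rfl⟩, _, ⟨n, rfl⟩, by simp [add_mul]⟩
  | monomial k a =>
    refine ((hg.image (a * ·)).insert 0).subset ?_
    rintro _ ⟨n, rfl⟩
    simp only [Polynomial.coe_monomial]
    rw [monomial_eq_C_mul_X_pow, mul_assoc, coeff_C_mul, coeff_X_pow_mul']
    split_ifs with h
    · exact Or.inr ⟨_, ⟨n - k, rfl⟩, rfl⟩
    · simp

open Filter Topology in
/-- A differential equation for a power series with finitely many coefficient values forces a
linear recurrence with constant coefficients. -/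
theorem exists_eventually_coeff_coe_mul_eq_zero {g : PowerSeries ℚ}
    (hg : (Set.range fun n ↦ coeff n g).Finite)
    (h : ¬ LinearIndependent (Polynomial ℚ) fun i : ℕ ↦ (eulerDerivation ℚ)^[i] g) :
    ∃ q : Polynomial ℚ, q ≠ 0 ∧ ∀ᶠ n in atTop, coeff n ((q : PowerSeries ℚ) * g) = 0 := by
  classical
  obtain ⟨c, hc, hc0⟩ := not_linearIndependent_iff_finsupp.1 h
  have hs : c.support.Nonempty := Finsupp.support_nonempty_iff.2 hc0
  set r := c.support.max' hs
  have hr : r ∈ c.support := Finset.max'_mem _ hs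
  refine ⟨c r, Finsupp.mem_support_iff.1 hr, ?_⟩
  refine Tendsto.eventually_eq_of_finite_range ?_ (finite_range_coeff_coe_mul _ hg)
  set D := c.support.sup fun i ↦ (c i).natDegree
  have hD : ∀ i ∈ c.support, (c i).natDegree ≤ D := fun i hi ↦
    Finset.le_sup (f := fun i ↦ (c i).natDegree) hi
  obtain ⟨C, hC⟩ : ∃ C, ∀ n, |coeff n g| ≤ C := by
    obtain ⟨C, hC⟩ := (hg.image abs).bddAbove
    exact ⟨C, fun n ↦ hC ⟨_, ⟨n, rfl⟩, rfl⟩⟩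
  -- For large `n` this sum is the `n`-th coefficient of `c r * g` minus that of the relation
  -- divided by `n ^ r`, which is zero. Each summand is bounded times null.
  have hlim : Tendsto (fun n : ℕ ↦ ∑ i ∈ c.support, ∑ k ∈ Finset.range (D + 1), (c i).coeff k *
      (coeff (n - k) g * ((if i = r then 1 else 0) - ((n - k : ℕ) : ℚ) ^ i / (n : ℚ) ^ r)))
      atTop (𝓝 (∑ i ∈ c.support, ∑ k ∈ Finset.range (D + 1), (c i).coeff k * 0)) := by
    refine tendsto_finsetSum _ fun i hi ↦ tendsto_finsetSum _ fun k _ ↦ ?_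
    refine Tendsto.const_mul _ (bdd_le_mul_tendsto_zero' C (.of_forall fun n ↦ hC _) ?_)
    simpa using (tendsto_const_nhds (x := (if i = r then 1 else 0 : ℚ))).sub
      (tendsto_natCast_sub_pow_div_pow k i r (Finset.le_max' _ i hi))
  simp only [mul_zero, Finset.sum_const_zero] at hlim
  refine hlim.congr' ?_
  filter_upwards [eventually_ge_atTop D] with n hn
  have h0 : ∑ i ∈ c.support, ∑ k ∈ Finset.range (D + 1),
      (c i).coeff k * (((n - k : ℕ) : ℚ) ^ i * coeff (n - k) g) = 0 := by
    have := congrArg (coeff n) hc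
    rw [Finsupp.sum, map_sum, map_zero] at this
    rw [← this]
    refine Finset.sum_congr rfl fun i hi ↦ ?_
    rw [Algebra.smul_def, algebraMap_apply', Algebra.algebraMap_self, map_id, id_eq,
      coeff_coe_mul_of_natDegree_le _ _ (hD i hi) hn]
    simp only [coeff_iterate_eulerDerivation]
  rw [coeff_coe_mul_of_natDegree_le _ _ (hD r hr) hn]
  simp only [mul_sub, Finset.sum_sub_distrib]
  rw [Finset.sum_eq_single_of_mem r hr (fun i _ hi ↦ by simp [hi])]
  have h1 : ∑ i ∈ c.support, ∑ k ∈ Finset.range (D + 1),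
      (c i).coeff k * (coeff (n - k) g * (((n - k : ℕ) : ℚ) ^ i / (n : ℚ) ^ r)) = 0 := by
    rw [← zero_div ((n : ℚ) ^ r), ← h0, Finset.sum_div]
    refine Finset.sum_congr rfl fun i _ ↦ ?_
    rw [Finset.sum_div]
    exact Finset.sum_congr rfl fun k _ ↦ by ring
  rw [h1]
  simp

end PowerSeries

/-! ### Recurrences, periodicity and rationality -/

/-- A sequence with finitely many values, each determined by the preceding `d`, is eventually
periodic. -/
theorem EventuallyPeriodic.of_finite_range {α : Type*} {a : ℕ → α} (ha : (Set.range a).Finite)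
    (d N : ℕ) (hrec : ∀ m n, N ≤ m → N ≤ n → (∀ i < d, a (m + i) = a (n + i)) →
      a (m + d) = a (n + d)) : EventuallyPeriodic a := by
  -- Only finitely many windows of length `d` occur, so two coincide; the recurrence propagates the
  -- equality.
  have hfin : (Set.range fun (n : ℕ) (i : Fin d) ↦ a (N + n + i)).Finite :=
    (Set.Finite.pi' fun _ ↦ ha).subset (by rintro _ ⟨n, rfl⟩ i; exact ⟨_, rfl⟩)
  obtain ⟨m, n, hmn, h⟩ : ∃ m n : ℕ, m < n ∧
      (fun i : Fin d ↦ a (N + m + i)) = fun i : Fin d ↦ a (N + n + i) := by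
    have := hfin.to_subtype
    obtain ⟨m, n, hne, h⟩ := Finite.exists_ne_map_eq_of_infinite
      (Set.rangeFactorization fun (n : ℕ) (i : Fin d) ↦ a (N + n + i))
    have h := congrArg Subtype.val h
    rcases hne.lt_or_gt with hlt | hlt
    · exact ⟨m, n, hlt, h⟩
    · exact ⟨n, m, hlt, h.symm⟩
  have key : ∀ i, a (N + m + i) = a (N + n + i) := by
    intro i
    induction i using Nat.strong_induction_on with
    | _ i ih =>
      by_cases hi : i < d
      · exact congrFun h ⟨i, hi⟩
      · obtain ⟨j, rfl⟩ := Nat.exists_eq_add_of_le (not_lt.1 hi)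
        have := hrec (N + m + j) (N + n + j) (by omega) (by omega) fun k hk ↦ by
          simpa only [add_assoc] using ih (j + k) (by omega)
        rwa [add_comm d j, ← add_assoc, ← add_assoc]
  refine ⟨N + m, n - m, by omega, fun k hk ↦ ?_⟩
  obtain ⟨i, rfl⟩ := Nat.exists_eq_add_of_le hk
  rw [key i]
  congr 1
  omega

namespace PowerSeries

open Filter

/-- The lowest nonzero coefficient of `q` multiplies the latest coefficient of `g` in the
convolution, so solving for it gives a recurrence of order `D - e`. -/
theorem eventuallyPeriodic_of_coe_mul {F : Type*} [Field F] {g : PowerSeries F}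
    (hg : (Set.range fun n ↦ coeff n g).Finite) {q : Polynomial F} (hq : q ≠ 0)
    (h : ∀ᶠ n in atTop, coeff n ((q : PowerSeries F) * g) = 0) :
    EventuallyPeriodic fun n ↦ coeff n g := by
  obtain ⟨N, hN⟩ := eventually_atTop.1 h
  set e := q.natTrailingDegree
  set D := q.natDegree
  have heD : e ≤ D := Polynomial.natTrailingDegree_le_natDegree q
  have hrec : ∀ m, N ≤ m → q.coeff e * coeff (m + (D - e)) g =
      - ∑ k ∈ (Finset.range (D + 1)).erase e, q.coeff k * coeff (m + D - k) g := by
    intro m hm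
    have := hN (m + D) (by omega)
    rw [coeff_coe_mul_of_natDegree_le q g le_rfl (by omega),
      ← Finset.add_sum_erase _ _ (Finset.mem_range.2 (show e < D + 1 by omega))] at this
    rw [← Nat.add_sub_assoc heD]
    exact eq_neg_of_add_eq_zero_left this
  refine .of_finite_range hg (D - e) N fun m n hm hn hmn ↦ ?_
  have he : q.coeff e ≠ 0 := Polynomial.trailingCoeff_nonzero_iff_nonzero.2 hq
  refine mul_left_cancel₀ he ?_
  simp only [hrec m hm, hrec n hn]
  congr 1
  refine Finset.sum_congr rfl fun k hk ↦ ?_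
  rw [Finset.mem_erase, Finset.mem_range] at hk
  rcases lt_or_gt_of_ne hk.1 with hlt | hgt
  · rw [Polynomial.coeff_eq_zero_of_lt_natTrailingDegree hlt, zero_mul, zero_mul]
  · have := hmn (D - k) (by omega)
    rw [Nat.add_sub_assoc (by omega), Nat.add_sub_assoc (by omega), this]

theorem exists_eq_coe_of_eventually_coeff_eq_zero {F : Type*} [CommSemiring F] {g : PowerSeries F}
    (h : ∀ᶠ n in atTop, coeff n g = 0) : ∃ p : Polynomial F, g = p := by
  obtain ⟨N, hN⟩ := eventually_atTop.1 h
  refine ⟨trunc N g, ext fun n ↦ ?_⟩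
  rw [Polynomial.coeff_coe, coeff_trunc]
  split_ifs with hn
  · rfl
  · exact hN n (not_lt.1 hn)

theorem algebraMap_coe_polynomial {F : Type*} [Field F] (p : Polynomial F) :
    algebraMap (RatFunc F) (LaurentSeries F) (algebraMap _ _ p) =
      HahnSeries.ofPowerSeries ℤ F (p : PowerSeries F) :=
  (RatFunc.coe_coe p).symm

theorem isRational_iff_exists_coe_mul (f : PowerSeries ℤ) :
    f.IsRational ↔ ∃ q : Polynomial ℚ, q ≠ 0 ∧ ∀ᶠ n in atTop,
      coeff n ((q : PowerSeries ℚ) * map (Int.castRingHom ℚ) f) = 0 := by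
  constructor
  · rintro ⟨r, hr⟩
    refine ⟨r.denom, r.denom_ne_zero, ?_⟩
    have h : (r.denom : PowerSeries ℚ) * map (Int.castRingHom ℚ) f = r.num := by
      apply HahnSeries.ofPowerSeries_injective (Γ := ℤ)
      rw [map_mul, ← algebraMap_coe_polynomial, ← algebraMap_coe_polynomial,
        show HahnSeries.ofPowerSeries ℤ ℚ (map (Int.castRingHom ℚ) f) = _ from hr.symm, ← map_mul]
      congr 1
      nth_rw 2 [← r.num_div_denom]
      exact mul_div_cancel₀ _ (RatFunc.algebraMap_ne_zero r.denom_ne_zero)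
    filter_upwards [eventually_gt_atTop r.num.natDegree] with n hn
    rw [h, Polynomial.coeff_coe, Polynomial.coeff_eq_zero_of_natDegree_lt hn]
  · rintro ⟨q, hq, h⟩
    obtain ⟨p, hp⟩ := exists_eq_coe_of_eventually_coeff_eq_zero h
    refine ⟨algebraMap _ _ p / algebraMap _ _ q, ?_⟩
    have hq' : algebraMap (RatFunc ℚ) (LaurentSeries ℚ) (algebraMap _ _ q) ≠ 0 := by
      rw [map_ne_zero]
      exact RatFunc.algebraMap_ne_zero hq
    rw [map_div₀, div_eq_iff hq', algebraMap_coe_polynomial, algebraMap_coe_polynomial, ← hp,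
      map_mul, mul_comm, toRatLaurent]

theorem isRational_of_isAlgebraic {f : PowerSeries ℤ}
    (hf : (Set.range fun n : ℕ ↦ coeff n f).Finite)
    (h : IsAlgebraic (RatFunc ℚ) f.toRatLaurent) : f.IsRational := by
  rw [isRational_iff_exists_coe_mul]
  have hg : (Set.range fun n ↦ coeff n (map (Int.castRingHom ℚ) f)).Finite := by
    refine (hf.image (Int.castRingHom ℚ)).subset ?_
    rintro _ ⟨n, rfl⟩
    exact ⟨_, ⟨n, rfl⟩, by simp⟩
  refine exists_eventually_coeff_coe_mul_eq_zero hg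
    ((eulerDerivation ℚ).not_linearIndependent_iterate (fun p ↦ ?_) ?_)
  · refine ⟨Polynomial.X * Polynomial.derivative p, ?_⟩
    simp only [algebraMap_apply', Algebra.algebraMap_self, map_id, id_eq]
    rw [eulerDerivation, Derivation.smul_apply, derivative_coe]
    simp
  -- Clearing denominators replaces ℚ(x) by ℚ[x]; the relation then descends to ℚ[[x]], where θ
  -- acts.
  · rw [← IsFractionRing.isAlgebraic_iff (Polynomial ℚ)] at h
    have : IsScalarTower (Polynomial ℚ) (PowerSeries ℚ) (LaurentSeries ℚ) :=
      .of_algebraMap_eq fun p ↦ by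
        rw [IsScalarTower.algebraMap_apply (Polynomial ℚ) (RatFunc ℚ) (LaurentSeries ℚ),
          algebraMap_coe_polynomial, algebraMap_apply', Algebra.algebraMap_self, map_id, id_eq,
          LaurentSeries.coe_algebraMap]
    exact (isAlgebraic_algebraMap_iff (A := LaurentSeries ℚ)
      (IsFractionRing.injective (PowerSeries ℚ) (LaurentSeries ℚ))).1 h

end PowerSeries

theorem mainTheorem7 (f : PowerSeries ℤ)
    (hf : (Set.range fun n : ℕ => PowerSeries.coeff n f).Finite) :
    Xor f.IsRational (Transcendental (RatFunc ℚ) f.toRatLaurent) ∧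
      (f.IsRational → EventuallyPeriodic fun n : ℕ => PowerSeries.coeff n f) := by
  refine ⟨?_, fun h ↦ ?_⟩
  · by_cases h : IsAlgebraic (RatFunc ℚ) f.toRatLaurent
    · exact Or.inl ⟨PowerSeries.isRational_of_isAlgebraic hf h, fun ht ↦ ht h⟩
    · refine Or.inr ⟨h, ?_⟩
      rintro ⟨r, hr⟩
      exact h (hr ▸ isAlgebraic_algebraMap r)
  · have hg : (Set.range fun n ↦ PowerSeries.coeff n (f.map (Int.castRingHom ℚ))).Finite := by
      refine (hf.image (Int.castRingHom ℚ)).subset ?_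
      rintro _ ⟨n, rfl⟩
      exact ⟨_, ⟨n, rfl⟩, by simp⟩
    obtain ⟨q, hq, hq0⟩ := f.isRational_iff_exists_coe_mul.1 h
    obtain ⟨N, T, hT, hNT⟩ := PowerSeries.eventuallyPeriodic_of_coe_mul hg hq hq0
    exact ⟨N, T, hT, fun n hn ↦ by simpa using hNT n hn⟩
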